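/- \textbf{Setting.} Consider $N\ge 1$ banks. Bank $i$ owes $\bar p_{ij}\ge 0$ to bank $j$ ($\bar p_{ii}=0$) and $\bar p_{i0}>0$ to society. Put $\bar p_i=\sum_{k=0}^N\bar p_{ik}$ and $\pi_{ij}=\bar p_{ij}/\bar p_i$ for $j=0,\dots,N$. For $x\in\mathbb R^N_+$ let $p(x)$ be the unique solution of the Eisenberg--Noe clearing equations $p_i(x)=\min\{\bar p_i,\ x_i+\sum_{j=1}^N\pi_{ji}p_j(x)\}$, $i=1,\dots,N$. Fix $\gamma\in(0,1)$ and define $\Lambda_i(x,m)=\pi_{i0}\,p_i(x+m)-\gamma\bar p_{i0}$ if $x+m\in\mathbb R^N_+$, and $\Lambda_i(x,m)=-\infty$ otherwise. Let $(\Omega,\mathcal F,\mathbb P)$ be a probability space, let $\rho\colon L^\infty(\mathbb R)\to\mathbb R$ be a coherent risk measure that is continuous from above, and let $\mathcal A=\{Y\in L^\infty(\mathbb R)\mid\rho(Y)\le 0\}$. For $X\in L^\infty(\mathbb R^N)$, a vector $v\in\mathbb R^N$ is a \emph{Nash allocation at $X$} if $$v_i=\inf\{m_i\in\mathbb R\mid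 \Lambda_i(X,(m_i,v_{-i}))\in\mathcal A\}\quad\text{for every }i,$$ where membership in $\mathcal A$ includes $X+(m_i,v_{-i})\in\mathbb R^N_+$ a.s. An \emph{EN Nash allocation rule} is a map $r\colon L^\infty(\mathbb R^N)\to\mathbb R^N$ such that $r(X)$ is a Nash allocation at $X$ for every $X$. \textbf{Statement.} \begin{enumerate} \item If $\pi_{i0}>\frac{N-2}{N-1}$ for every $i$ (no condition if $N=1$), then there exists a unique EN Nash allocation rule. \item Let $x\in\mathbb R^N$. All EN Nash allocation rules take the same value $m(x)$ at the deterministic shock $X=x$, and $m(x)$ is the unique Nash allocation at $X=x$. It is computed by the following iteration. Start with $I^0=\emptyset$. Given $I^k$, let $p^k\in\mathbb R^N$ be the unique vector with $p^k_i=\gamma\bar p_i$ for $i\notin I^k$ and $p^k_i=\min\{\bar p_i,\ \gamma\sum_{j\notin I^k}\bar p_{ji}+\sum_{j\in I^k}\pi_{ji}p^k_j\}$ for $i\in I^k$. Put $m^k_i=-x_i+\gamma\bar p_i-\sum_{j=1}^N\pi_{ji}p^k_j$ for $i\notin I^k$ and $m^k_i=-x_i$ for $i\in I^k$, and let $I^{k+1}=\{i\mid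 m^k_i\le -x_i\}$. Then $I^k\subseteq I^{k+1}$ for all $k$, the first $k$ with $I^{k+1}=I^k$ satisfies $k<N$ (so at most $N$ iterations are needed), and $m(x)=m^k$ for this $k$. \end{enumerate} -/

import Mathlib

open MeasureTheory Filter Topology
open scoped ENNReal

noncomputable section

/-- A network of `N` banks. `owed i j` is the obligation of bank `i` to bank `j`,
`society i` the (strictly positive) obligation of bank `i` outside of the system. -/
structure FinancialNetwork (N : ℕ) where
  owed : Fin N → Fin N → ℝ
  society : Fin N → ℝ
  owed_nonneg : ∀ i j, 0 ≤ owed i j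
  owed_self : ∀ i, owed i i = 0
  society_pos : ∀ i, 0 < society i

namespace FinancialNetwork

variable {N : ℕ} (net : FinancialNetwork N)

/-- Total obligations of bank `i`, to society and to the other banks. -/
def total (i : Fin N) : ℝ := net.society i + ∑ j, net.owed i j

/-- Relative liability of bank `i` to bank `j`. -/
def rel (i j : Fin N) : ℝ := net.owed i j / net.total i

/-- Relative liability of bank `i` to society. -/
def relSociety (i : Fin N) : ℝ := net.society i / net.total i

theorem total_pos (i : Fin N) : 0 < net.total i :=
  add_pos_of_pos_of_nonneg (net.society_pos i)
    (Finset.sum_nonneg fun j _ => net.owed_nonneg i j)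

theorem rel_nonneg (i j : Fin N) : 0 ≤ net.rel i j :=
  div_nonneg (net.owed_nonneg i j) (net.total_pos i).le

theorem sum_rel_lt_one (i : Fin N) : ∑ j, net.rel i j < 1 := by
  unfold rel
  rw [← Finset.sum_div, div_lt_one (net.total_pos i)]
  have := net.society_pos i
  unfold total
  linarith

theorem exists_sum_rel_le : ∃ K : ℝ, 0 ≤ K ∧ K < 1 ∧ ∀ i, ∑ j, net.rel i j ≤ K := by
  rcases isEmpty_or_nonempty (Fin N) with h | h
  · exact ⟨0, le_rfl, one_pos, fun i => h.elim i⟩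
  · obtain ⟨i, hi⟩ := Finite.exists_max fun i => ∑ j, net.rel i j
    exact ⟨_, Finset.sum_nonneg fun j _ => net.rel_nonneg i j, net.sum_rel_lt_one i, hi⟩

/-- Well-posedness of the clearing problem in which the banks in `I` clear and every other
bank `i` makes the fixed payment `c i`. -/
theorem existsUnique_clearing (I : Finset (Fin N)) (c : Fin N → ℝ) :
    ∃! p : Fin N → ℝ, ∀ i, p i =
      if i ∈ I then min (net.total i) (c i + ∑ j ∈ I, net.rel j i * p j) else c i := by
  classical
  obtain ⟨K, hK0, hK1, hK⟩ := net.exists_sum_rel_le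
  let F : (Fin N → ℝ) → Fin N → ℝ := fun p i =>
    if i ∈ I then min (net.total i) (c i + ∑ j ∈ I, net.rel j i * p j) else c i
  have key : ∀ p q : Fin N → ℝ, ∑ i, |F p i - F q i| ≤ K * ∑ i, |p i - q i| := by
    intro p q
    have h1 : ∀ i, |F p i - F q i| ≤ ∑ j, net.rel j i * |p j - q j| := by
      intro i
      have hnn : ∀ j, 0 ≤ net.rel j i * |p j - q j| := fun j =>
        mul_nonneg (net.rel_nonneg j i) (abs_nonneg _)
      by_cases hi : i ∈ I
      · simp only [F, hi, if_true]
        refine (abs_min_sub_min_le_max _ _ _ _).trans ?_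
        rw [sub_self, abs_zero, max_eq_right (abs_nonneg _), add_sub_add_left_eq_sub,
          ← Finset.sum_sub_distrib]
        refine (Finset.abs_sum_le_sum_abs _ _).trans ?_
        refine (Finset.sum_le_sum fun j _ => ?_).trans
          (Finset.sum_le_sum_of_subset_of_nonneg (Finset.subset_univ I) fun j _ _ => hnn j)
        rw [← mul_sub, abs_mul, abs_of_nonneg (net.rel_nonneg j i)]
      · simp only [F, hi, if_false, sub_self, abs_zero]
        exact Finset.sum_nonneg fun j _ => hnn j
    calc ∑ i, |F p i - F q i| ≤ ∑ i, ∑ j, net.rel j i * |p j - q j| :=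
          Finset.sum_le_sum fun i _ => h1 i
      _ = ∑ j, (∑ i, net.rel j i) * |p j - q j| := by
          rw [Finset.sum_comm]
          simp only [Finset.sum_mul]
      _ ≤ ∑ j, K * |p j - q j| :=
          Finset.sum_le_sum fun j _ => mul_le_mul_of_nonneg_right (hK j) (abs_nonneg _)
      _ = K * ∑ i, |p i - q i| := by rw [Finset.mul_sum]
  let G : PiLp 1 (fun _ : Fin N => ℝ) → PiLp 1 (fun _ : Fin N => ℝ) := fun p =>
    WithLp.toLp 1 (F (WithLp.ofLp p))
  have hd : ∀ p q : PiLp 1 (fun _ : Fin N => ℝ), dist p q = ∑ i, |p i - q i| := by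
    intro p q
    rw [PiLp.dist_eq_sum (by norm_num)]
    simp [Real.dist_eq]
  have hG : ContractingWith ⟨K, hK0⟩ G := by
    refine ⟨?_, LipschitzWith.of_dist_le_mul fun p q => ?_⟩
    · exact_mod_cast hK1
    · rw [hd, hd]
      exact key _ _
  refine ⟨WithLp.ofLp (hG.fixedPoint G), fun i => ?_, fun q hq => ?_⟩
  · have h := hG.fixedPoint_isFixedPt (f := G)
    exact (congrFun (congrArg WithLp.ofLp h) i).symm
  · have h : G (WithLp.toLp 1 q) = WithLp.toLp 1 q := by
      have : F q = q := funext fun i => (hq i).symm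
      simp only [G, this]
    have h' := hG.fixedPoint_unique (x := WithLp.toLp 1 q) h
    exact congrArg WithLp.ofLp h'

/-- `p` solves the clearing equation
`p_i = min (total obligations of i) (x_i + ∑_j π_{ji} p_j)` for external assets `x`. -/
def IsClearingVector (x p : Fin N → ℝ) : Prop :=
  ∀ i, p i = min (net.total i) (x i + ∑ j, net.rel j i * p j)

theorem existsUnique_isClearingVector (x : Fin N → ℝ) : ∃! p, net.IsClearingVector x p := by
  simpa [IsClearingVector] using net.existsUnique_clearing Finset.univ x

/-- The clearing payment vector `p(x)`. -/
def clearingVector (x : Fin N → ℝ) : Fin N → ℝ :=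
  Classical.choose (net.existsUnique_isClearingVector x).exists

open Classical in
/-- The natural decomposition of the single-element aggregation function of the network: on
`x ≥ 0` the payment of bank `i` to society minus the required fraction `γ` of its obligation,
and `-∞` elsewhere. -/
def singleAggregation (γ : ℝ) (i : Fin N) (x : Fin N → ℝ) : WithBot ℝ :=
  if ∀ j, 0 ≤ x j then
    ((net.relSociety i * net.clearingVector x i - γ * net.society i : ℝ) : WithBot ℝ)
  else ⊥

/-- The sensitive form: shock `x` plus capital `m` is aggregated. -/
def aggregation (γ : ℝ) (i : Fin N) (x m : Fin N → ℝ) : WithBot ℝ :=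
  net.singleAggregation γ i (x + m)

/-- The payments in one stage of the iteration: banks outside of `I` pay exactly the fraction
`γ` of their obligations, banks in `I` clear without any capital. -/
def IsStagePayment (γ : ℝ) (I : Finset (Fin N)) (p : Fin N → ℝ) : Prop :=
  (∀ i, i ∉ I → p i = γ * net.total i) ∧
  ∀ i, i ∈ I → p i =
    min (net.total i) (γ * ∑ j ∈ Iᶜ, net.owed j i + ∑ j ∈ I, net.rel j i * p j)

theorem existsUnique_isStagePayment (γ : ℝ) (I : Finset (Fin N)) :
    ∃! p, net.IsStagePayment γ I p := by
  have h := net.existsUnique_clearing I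
    fun i => if i ∈ I then γ * ∑ j ∈ Iᶜ, net.owed j i else γ * net.total i
  refine (existsUnique_congr fun p => ?_).mp h
  constructor
  · intro hp
    refine ⟨fun i hi => ?_, fun i hi => ?_⟩
    · have := hp i
      simpa [hi] using this
    · have := hp i
      simpa only [hi, if_true] using this
  · rintro ⟨h1, h2⟩ i
    by_cases hi : i ∈ I
    · simpa only [hi, if_true] using h2 i hi
    · simpa [hi] using h1 i hi

/-- The unique payments of the stage with set `I`. -/
def stagePayment (γ : ℝ) (I : Finset (Fin N)) : Fin N → ℝ :=
  Classical.choose (net.existsUnique_isStagePayment γ I).exists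

/-- The allocation of the stage with set `I`, for the asset values `x`. -/
def stageAllocation (γ : ℝ) (x : Fin N → ℝ) (I : Finset (Fin N)) (i : Fin N) : ℝ :=
  if i ∈ I then -x i
  else -x i + γ * net.total i - ∑ j, net.rel j i * net.stagePayment γ I j

open Classical in
/-- The iterated sets `I^0 = ∅`, `I^{k+1} = {i | m_i^k ≤ -x_i}`, where `m^k` is the allocation
of the stage with set `I^k`. -/
def stageSet (γ : ℝ) (x : Fin N → ℝ) : ℕ → Finset (Fin N)
  | 0 => ∅
  | k + 1 => Finset.univ.filter fun i =>
      net.stageAllocation γ x (stageSet γ x k) i ≤ -x i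

end FinancialNetwork

section RiskMeasures

variable {Ω : Type*} [MeasurableSpace Ω] {P : Measure Ω} [IsProbabilityMeasure P]

/-- Coherent risk measures on `L^∞(ℝ)`; the order of `Lp` is the almost sure order. -/
structure IsCoherentRiskMeasure (ρ : Lp ℝ ∞ P → ℝ) : Prop where
  normalized : ρ 0 = 0
  monotone : ∀ Y Z : Lp ℝ ∞ P, Z ≤ Y → ρ Y ≤ ρ Z
  translative : ∀ (Y : Lp ℝ ∞ P) (m : ℝ), ρ (Y + Lp.const ∞ P m) = ρ Y - m
  convex : ∀ (Y Z : Lp ℝ ∞ P) (a : ℝ), 0 ≤ a → a ≤ 1 →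
    ρ (a • Y + (1 - a) • Z) ≤ a * ρ Y + (1 - a) * ρ Z
  homogeneous : ∀ (Y : Lp ℝ ∞ P) (a : ℝ), 0 ≤ a → ρ (a • Y) = a * ρ Y

/-- Continuity from above: `Y^n ↓ Y` almost surely implies `ρ(Y^n) → ρ(Y)` (the convergence is
increasing as soon as `ρ` is monotone). -/
def IsContinuousFromAbove (ρ : Lp ℝ ∞ P → ℝ) : Prop :=
  ∀ (Y : ℕ → Lp ℝ ∞ P) (Z : Lp ℝ ∞ P), Antitone Y →
    (∀ᵐ ω ∂P, Tendsto (fun n => Y n ω) atTop (𝓝 (Z ω))) →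
    Tendsto (fun n => ρ (Y n)) atTop (𝓝 (ρ Z))

/-- The acceptance set of `ρ`. -/
def acceptanceSet (ρ : Lp ℝ ∞ P → ℝ) : Set (Lp ℝ ∞ P) := {Y | ρ Y ≤ 0}

/-- The deterministic shock `X = x`. -/
def constShock (P : Measure Ω) [IsProbabilityMeasure P] {N : ℕ} (x : Fin N → ℝ) :
    Fin N → Lp ℝ ∞ P :=
  fun i => Lp.const ∞ P (x i)

/-- The `ℝ ∪ {-∞}`-valued random variable `Λ(X, m)` is an element of `A`; in particular it is
almost surely finite and belongs to `L^∞(ℝ)`. -/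
def IsAcceptable {N : ℕ} (A : Set (Lp ℝ ∞ P)) (L : (Fin N → ℝ) → (Fin N → ℝ) → WithBot ℝ)
    (X : Fin N → Lp ℝ ∞ P) (m : Fin N → ℝ) : Prop :=
  ∃ Y ∈ A, ∀ᵐ ω ∂P, L (fun j => X j ω) m = ((Y ω : ℝ) : WithBot ℝ)

/-- `v` is a Nash allocation at `X`: for each `i`, the real number `v_i` is the infimum of the
`m_i` for which `Λ_i(X, (m_i, v_{-i}))` is in `A`. (A greatest lower bound in `ℝ` exists only if
this set is nonempty and bounded below, so no convention for other infima enters.) -/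
def IsNashAllocationAt {N : ℕ} (A : Set (Lp ℝ ∞ P))
    (L : Fin N → (Fin N → ℝ) → (Fin N → ℝ) → WithBot ℝ)
    (X : Fin N → Lp ℝ ∞ P) (v : Fin N → ℝ) : Prop :=
  ∀ i, IsGLB {mi : ℝ | IsAcceptable A (L i) X (Function.update v i mi)} (v i)

/-- Nash allocation rules `r : L^∞(ℝ^N) → ℝ^N`. -/
def IsNashAllocationRule {N : ℕ} (A : Set (Lp ℝ ∞ P))
    (L : Fin N → (Fin N → ℝ) → (Fin N → ℝ) → WithBot ℝ)
    (r : (Fin N → Lp ℝ ∞ P) → Fin N → ℝ) : Prop :=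
  ∀ X, IsNashAllocationAt A L X (r X)

end RiskMeasures

end

/-! The row sums of `rel` are bounded by some `K < 1`, so passing losses through the network shrinks
their total. This gives one comparison principle, `le_of_forall_le_or_sub_le`, which underlies the
monotonicity of clearing payments and the uniqueness of payments in the deterministic case.

For the existence of a unique rule, fix `X`: Nash allocations are the fixed points of the map
sending an allocation to the best replies of the banks. If every other bank loses at most `d`, then
`(N - 1) * K * d` of additional own capital restores the payment of bank `i`
(`clearingVector_le_of_compensated`, `isAcceptable_update_add`). Hence best replies are Lipschitz
with constant `(N - 1) * K` in the sup metric. The condition on `relSociety` makes this constant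
less than one, and Banach's theorem applies.

For a deterministic shock, acceptability says that bank `i` pays at least `γ * total i`. At a Nash
allocation a bank left with positive assets pays exactly that amount, and a bank without assets
passes on what it receives. The payments therefore solve `IsToppedUpPayment`, whose solution is
unique by comparison and determines the allocation; conversely, that allocation is Nash. Stage
payments never fall below the level `γ * total`, the stage sets grow and never contain all banks,
and a stationary stage solves the equation. -/

noncomputable section

/-! ### Comparison, monotonicity and continuity of clearing payments. -/

namespace FinancialNetwork

variable {N : ℕ} (net : FinancialNetwork N)

/-- Comparison principle for the clearing operators of a network. -/
theorem le_of_forall_le_or_sub_le {p q : Fin N → ℝ}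
    (h : ∀ i, p i ≤ q i ∨ p i - q i ≤ ∑ j, net.rel j i * max (p j - q j) 0) : p ≤ q := by
  obtain ⟨K, -, hK1, hK⟩ := net.exists_sum_rel_le
  have hnn : ∀ j, 0 ≤ max (p j - q j) 0 := fun j => le_max_right _ _
  have h1 : ∀ i, max (p i - q i) 0 ≤ ∑ j, net.rel j i * max (p j - q j) 0 := by
    intro i
    have h0 : 0 ≤ ∑ j, net.rel j i * max (p j - q j) 0 :=
      Finset.sum_nonneg fun j _ => mul_nonneg (net.rel_nonneg j i) (hnn j)
    rcases h i with h | h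
    · exact max_le (by linarith) h0
    · exact max_le h h0
  -- Summing over the receiving banks turns the coefficients into row sums of `rel`; as `K < 1`, the
  -- total positive part must vanish.
  have h2 : ∑ i, max (p i - q i) 0 ≤ K * ∑ i, max (p i - q i) 0 :=
    calc ∑ i, max (p i - q i) 0 ≤ ∑ i, ∑ j, net.rel j i * max (p j - q j) 0 :=
          Finset.sum_le_sum fun i _ => h1 i
      _ = ∑ j, (∑ i, net.rel j i) * max (p j - q j) 0 := by
          rw [Finset.sum_comm]
          simp only [Finset.sum_mul]
      _ ≤ ∑ j, K * max (p j - q j) 0 :=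
          Finset.sum_le_sum fun j _ => mul_le_mul_of_nonneg_right (hK j) (hnn j)
      _ = K * ∑ i, max (p i - q i) 0 := by rw [Finset.mul_sum]
  have h3 : ∑ i, max (p i - q i) 0 = 0 := by
    have := Finset.sum_nonneg fun i (_ : i ∈ Finset.univ) => hnn i
    nlinarith
  intro i
  have := (Finset.sum_eq_zero_iff_of_nonneg fun i _ => hnn i).1 h3 i (Finset.mem_univ i)
  have := le_max_left (p i - q i) 0
  linarith

theorem sum_rel_mul_sub_le (p q : Fin N → ℝ) (i : Fin N) :
    ∑ j, net.rel j i * p j - ∑ j, net.rel j i * q j ≤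
      ∑ j, net.rel j i * max (p j - q j) 0 := by
  rw [← Finset.sum_sub_distrib]
  refine Finset.sum_le_sum fun j _ => ?_
  rw [← mul_sub]
  exact mul_le_mul_of_nonneg_left (le_max_left _ _) (net.rel_nonneg j i)

theorem sum_rel_mul_mono {p q : Fin N → ℝ} (h : p ≤ q) (i : Fin N) :
    ∑ j, net.rel j i * p j ≤ ∑ j, net.rel j i * q j :=
  Finset.sum_le_sum fun j _ => mul_le_mul_of_nonneg_left (h j) (net.rel_nonneg j i)

theorem clearingVector_spec (x : Fin N → ℝ) : net.IsClearingVector x (net.clearingVector x) :=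
  Classical.choose_spec (net.existsUnique_isClearingVector x).exists

theorem IsClearingVector.eq_clearingVector {x p : Fin N → ℝ} (h : net.IsClearingVector x p) :
    p = net.clearingVector x :=
  (net.existsUnique_isClearingVector x).unique h (net.clearingVector_spec x)

theorem clearingVector_le_total (x : Fin N → ℝ) (i : Fin N) :
    net.clearingVector x i ≤ net.total i := by
  rw [net.clearingVector_spec x i]
  exact min_le_left _ _

theorem clearingVector_le (x : Fin N → ℝ) (i : Fin N) :
    net.clearingVector x i ≤ x i + ∑ j, net.rel j i * net.clearingVector x j := by
  conv_lhs => rw [net.clearingVector_spec x i]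
  exact min_le_right _ _

/-- A lower payment means that the bank defaults. -/
theorem clearingVector_eq_of_lt {x : Fin N → ℝ} {i : Fin N}
    (h : net.clearingVector x i < net.total i) :
    net.clearingVector x i = x i + ∑ j, net.rel j i * net.clearingVector x j := by
  have hs := net.clearingVector_spec x i
  rcases min_choice (net.total i) (x i + ∑ j, net.rel j i * net.clearingVector x j) with h' | h'
  · rw [h'] at hs
    exact absurd hs h.ne
  · rwa [h'] at hs

theorem clearingVector_mono {x y : Fin N → ℝ} (h : x ≤ y) :
    net.clearingVector x ≤ net.clearingVector y := by
  refine net.le_of_forall_le_or_sub_le fun i => ?_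
  rcases lt_or_ge (net.clearingVector y i) (net.total i) with hy | hy
  · right
    rw [net.clearingVector_eq_of_lt hy]
    have := net.clearingVector_le x i
    have := net.sum_rel_mul_sub_le (net.clearingVector x) (net.clearingVector y) i
    linarith [h i]
  · exact Or.inl ((net.clearingVector_le_total x i).trans hy)

theorem clearingVector_nonneg {x : Fin N → ℝ} (h : ∀ j, 0 ≤ x j) (i : Fin N) :
    0 ≤ net.clearingVector x i := by
  have h0 : net.IsClearingVector 0 0 := fun i => by simp [(net.total_pos i).le]
  have := net.clearingVector_mono (x := 0) h i
  rwa [← h0.eq_clearingVector] at this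

theorem clearingVector_eq_total {x : Fin N → ℝ} (h : ∀ j, 0 ≤ x j) {i : Fin N}
    (hi : net.total i ≤ x i) : net.clearingVector x i = net.total i := by
  rw [net.clearingVector_spec x i]
  refine min_eq_left (hi.trans (le_add_of_nonneg_right ?_))
  exact Finset.sum_nonneg fun j _ => mul_nonneg (net.rel_nonneg j i) (net.clearingVector_nonneg h j)

/-- Losses `d k` of the other banks are compensated, for the payments of bank `i`, by additional
capital `K * ∑ d k` of bank `i` if all relative interbank liabilities are at most `K`. -/
theorem clearingVector_le_of_compensated {K : ℝ} (hK1 : K < 1)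
    (hK : ∀ i, ∑ j, net.rel i j ≤ K) {x y d : Fin N → ℝ} {i : Fin N} (hd : ∀ k, 0 ≤ d k)
    (hi : x i + K * ∑ k ∈ Finset.univ.erase i, d k ≤ y i) (hxy : ∀ k, k ≠ i → x k - d k ≤ y k) :
    net.clearingVector x i ≤ net.clearingVector y i := by
  have hK0 : 0 ≤ K := (Finset.sum_nonneg fun j _ => net.rel_nonneg i j).trans (hK i)
  set p := net.clearingVector x
  set q := net.clearingVector y
  set D : Fin N → ℝ := fun j => max (p j - q j) 0 with hD
  have hDnn : ∀ j, 0 ≤ D j := fun j => le_max_right _ _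
  by_contra! hlt
  have hbound : ∀ k, q k < p k → p k - q k ≤ x k - y k + ∑ j, net.rel j k * D j := by
    intro k hk
    have h1 := net.clearingVector_le x k
    have h2 := net.clearingVector_eq_of_lt (hk.trans_le (net.clearingVector_le_total x k))
    have h3 := net.sum_rel_mul_sub_le p q k
    simp only [hD]
    change p k ≤ _ at h1
    change q k = _ at h2
    linarith
  have hDi : D i ≤ -(K * ∑ k ∈ Finset.univ.erase i, d k) + ∑ j, net.rel j i * D j := by
    have := hbound i hlt
    have : D i = p i - q i := max_eq_left (by linarith)
    linarith
  have hDk : ∀ k ∈ Finset.univ.erase i, K * D k ≤ K * (d k + ∑ j, net.rel j k * D j) := by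
    intro k hk
    refine mul_le_mul_of_nonneg_left ?_ hK0
    have h0 : 0 ≤ ∑ j, net.rel j k * D j :=
      Finset.sum_nonneg fun j _ => mul_nonneg (net.rel_nonneg j k) (hDnn j)
    refine max_le ?_ (add_nonneg (hd k) h0)
    rcases le_or_gt (p k) (q k) with h | h
    · linarith [hd k]
    · linarith [hbound k h, hxy k (Finset.ne_of_mem_erase hk)]
  have hsum := Finset.sum_le_sum hDk
  rw [← Finset.mul_sum, ← Finset.mul_sum, Finset.sum_add_distrib, mul_add] at hsum
  -- The weights are `1` at `i` and `K` elsewhere.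
  have hw : ∑ j, net.rel j i * D j + K * ∑ k ∈ Finset.univ.erase i, ∑ j, net.rel j k * D j
      ≤ K * ∑ j, D j := by
    rw [Finset.sum_comm, Finset.mul_sum, Finset.mul_sum, ← Finset.sum_add_distrib]
    refine Finset.sum_le_sum fun j _ => ?_
    -- The coefficient of `D j` is `rel j i` plus `K` times the rest of row `j`. Since `K < 1`, it
    -- is at most the whole row sum, hence at most `K`.
    rw [← Finset.sum_mul, ← mul_assoc, ← add_mul]
    refine mul_le_mul_of_nonneg_right ?_ (hDnn j)
    have h1 := Finset.add_sum_erase Finset.univ (net.rel j) (Finset.mem_univ i)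
    have h2 : 0 ≤ ∑ k ∈ Finset.univ.erase i, net.rel j k :=
      Finset.sum_nonneg fun k _ => net.rel_nonneg j k
    have h3 := hK j
    nlinarith
  rw [← Finset.add_sum_erase Finset.univ D (Finset.mem_univ i), mul_add] at hw
  -- In the weighted sum the losses `d` cancel against the compensation and the terms `K * D k` with
  -- `k ≠ i` cancel too, leaving `D i ≤ K * D i`.
  have hpos : 0 < D i := lt_max_of_lt_left (by linarith)
  nlinarith

/-- The clearing map is even Lipschitz in the `ℓ¹` distance, with constant `1 / (1 - K)`. -/
theorem continuous_clearingVector : Continuous net.clearingVector := by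
  obtain ⟨K, hK0, hK1, hK⟩ := net.exists_sum_rel_le
  have key : ∀ x y : Fin N → ℝ,
      (1 - K) * ∑ i, |net.clearingVector x i - net.clearingVector y i| ≤ ∑ i, |x i - y i| := by
    intro x y
    set p := net.clearingVector x with hp
    set q := net.clearingVector y with hq
    have h1 : ∀ i, |p i - q i| ≤ |x i - y i| + ∑ j, net.rel j i * |p j - q j| := by
      intro i
      rw [hp, hq, net.clearingVector_spec x i, net.clearingVector_spec y i, ← hp, ← hq]
      refine (abs_min_sub_min_le_max _ _ _ _).trans ?_
      rw [sub_self, abs_zero, max_eq_right (abs_nonneg _), add_sub_add_comm,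
        ← Finset.sum_sub_distrib]
      refine (abs_add_le _ _).trans (add_le_add_right ?_ _)
      refine (Finset.abs_sum_le_sum_abs _ _).trans (Finset.sum_le_sum fun j _ => ?_)
      rw [← mul_sub, abs_mul, abs_of_nonneg (net.rel_nonneg j i)]
    have h2 := Finset.sum_le_sum fun i (_ : i ∈ Finset.univ) => h1 i
    rw [Finset.sum_add_distrib, Finset.sum_comm (γ := Fin N)] at h2
    have h3 : ∑ j, ∑ i, net.rel j i * |p j - q j| ≤ K * ∑ j, |p j - q j| := by
      rw [Finset.mul_sum]
      refine Finset.sum_le_sum fun j _ => ?_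
      rw [← Finset.sum_mul]
      exact mul_le_mul_of_nonneg_right (hK j) (abs_nonneg _)
    linarith
  rw [continuous_iff_continuousAt]
  intro x
  rw [ContinuousAt, tendsto_pi_nhds]
  intro i
  rw [tendsto_iff_dist_tendsto_zero]
  have hlim : Tendsto (fun y : Fin N → ℝ => (∑ j, |y j - x j|) / (1 - K)) (𝓝 x) (𝓝 0) := by
    have : Continuous fun y : Fin N → ℝ => (∑ j, |y j - x j|) / (1 - K) := by fun_prop
    simpa using this.tendsto x
  refine squeeze_zero (fun _ => dist_nonneg) (fun y => ?_) hlim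
  rw [le_div_iff₀ (by linarith), mul_comm]
  refine (mul_le_mul_of_nonneg_left ?_ (by linarith)).trans (key y x)
  rw [Real.dist_eq]
  exact Finset.single_le_sum (f := fun j => |net.clearingVector y j - net.clearingVector x j|)
    (fun j _ => abs_nonneg _) (Finset.mem_univ i)

theorem relSociety_pos (i : Fin N) : 0 < net.relSociety i :=
  div_pos (net.society_pos i) (net.total_pos i)

theorem relSociety_mul_total (i : Fin N) : net.relSociety i * net.total i = net.society i :=
  div_mul_cancel₀ _ (net.total_pos i).ne'

theorem relSociety_add_sum_rel (i : Fin N) : net.relSociety i + ∑ j, net.rel i j = 1 := by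
  unfold relSociety rel
  rw [← Finset.sum_div, ← add_div]
  exact div_self (net.total_pos i).ne'

theorem aggregation_eq_coe {γ : ℝ} {i : Fin N} {x m : Fin N → ℝ} (h : ∀ j, 0 ≤ x j + m j) :
    net.aggregation γ i x m =
      ((net.relSociety i * net.clearingVector (x + m) i - γ * net.society i : ℝ) : WithBot ℝ) :=
  if_pos h

theorem aggregation_eq_coe_iff {γ : ℝ} {i : Fin N} {x m : Fin N → ℝ} {y : ℝ} :
    net.aggregation γ i x m = (y : WithBot ℝ) ↔ (∀ j, 0 ≤ x j + m j) ∧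
      net.relSociety i * net.clearingVector (x + m) i - γ * net.society i = y := by
  by_cases h : ∀ j, 0 ≤ x j + m j
  · rw [net.aggregation_eq_coe h, WithBot.coe_inj]
    exact ⟨fun h' => ⟨h, h'⟩, fun h' => h'.2⟩
  · have : net.aggregation γ i x m = ⊥ := if_neg h
    rw [this]
    simp [h]

/-! ### Acceptability and monotonicity in the payment. -/

section Acceptability

variable {Ω : Type*} [MeasurableSpace Ω] {P : Measure Ω} {γ : ℝ}
  {X : Fin N → Lp ℝ ∞ P} {v w : Fin N → ℝ} {i : Fin N}

theorem nonneg_of_isAcceptable {A : Set (Lp ℝ ∞ P)}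
    (h : IsAcceptable A (net.aggregation γ i) X v) (j : Fin N) : ∀ᵐ ω ∂P, 0 ≤ X j ω + v j := by
  obtain ⟨Y, -, hY⟩ := h
  filter_upwards [hY] with ω hω
  exact (net.aggregation_eq_coe_iff.1 hω).1 j

/-- Measurability comes from continuity of the clearing map, boundedness from payments lying between
`0` and `total i`. -/
theorem exists_Lp_aggregation (γ : ℝ) (i : Fin N) (h : ∀ j, ∀ᵐ ω ∂P, 0 ≤ X j ω + v j) :
    ∃ Y : Lp ℝ ∞ P, ∀ᵐ ω ∂P,
      net.aggregation γ i (fun j => X j ω) v = ((Y ω : ℝ) : WithBot ℝ) := by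
  let f : Ω → ℝ := fun ω =>
    net.relSociety i * net.clearingVector ((fun j => X j ω) + v) i - γ * net.society i
  have hm : AEStronglyMeasurable f P := by
    have hX : AEStronglyMeasurable (fun ω => (fun j => X j ω) + v) P := by
      refine AEMeasurable.aestronglyMeasurable (aemeasurable_pi_lambda _ fun j => ?_)
      exact (Lp.aestronglyMeasurable (X j)).aemeasurable.add_const (v j)
    have hc : Continuous fun x : Fin N → ℝ =>
        net.relSociety i * net.clearingVector x i - γ * net.society i := by
      have := (continuous_apply i).comp net.continuous_clearingVector
      exact (this.const_mul _).sub continuous_const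
    exact hc.comp_aestronglyMeasurable hX
  have hb : MemLp f ∞ P := by
    refine memLp_top_of_bound hm (net.relSociety i * net.total i + |γ * net.society i|) ?_
    filter_upwards [ae_all_iff.2 h] with ω hω
    have h0 := net.clearingVector_nonneg (x := (fun j => X j ω) + v) hω i
    have h1 := net.clearingVector_le_total ((fun j => X j ω) + v) i
    have h2 := net.relSociety_pos i
    refine (norm_sub_le _ _).trans (add_le_add ?_ le_rfl)
    rw [Real.norm_of_nonneg (mul_nonneg h2.le h0)]
    exact mul_le_mul_of_nonneg_left h1 h2.le
  refine ⟨hb.toLp f, ?_⟩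
  filter_upwards [ae_all_iff.2 h, hb.coeFn_toLp] with ω hω hω'
  rw [hω', net.aggregation_eq_coe hω]

theorem isAcceptable_mono [IsProbabilityMeasure P] {ρ : Lp ℝ ∞ P → ℝ} (hρ : IsCoherentRiskMeasure ρ)
    (hv : IsAcceptable (acceptanceSet ρ) (net.aggregation γ i) X v)
    (hw : ∀ j, ∀ᵐ ω ∂P, 0 ≤ X j ω + w j)
    (hvw : ∀ᵐ ω ∂P, net.clearingVector ((fun j => X j ω) + v) i ≤
      net.clearingVector ((fun j => X j ω) + w) i) :
    IsAcceptable (acceptanceSet ρ) (net.aggregation γ i) X w := by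
  obtain ⟨Y, hYA, hY⟩ := hv
  obtain ⟨Z, hZ⟩ := net.exists_Lp_aggregation γ i hw
  refine ⟨Z, (hρ.monotone Z Y ?_).trans hYA, hZ⟩
  rw [← Lp.coeFn_le]
  filter_upwards [hY, hZ, hvw] with ω h1 h2 h3
  rw [← (net.aggregation_eq_coe_iff.1 h1).2, ← (net.aggregation_eq_coe_iff.1 h2).2]
  have := mul_le_mul_of_nonneg_left h3 (net.relSociety_pos i).le
  linarith


end Acceptability

end FinancialNetwork

theorem IsCoherentRiskMeasure.apply_const {Ω : Type*} [MeasurableSpace Ω] {P : Measure Ω}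
    [IsProbabilityMeasure P] {ρ : Lp ℝ ∞ P → ℝ} (hρ : IsCoherentRiskMeasure ρ) (c : ℝ) :
    ρ (Lp.const ∞ P c) = -c := by
  have := hρ.translative 0 c
  rwa [zero_add, hρ.normalized, zero_sub] at this

/-- The threshold is the essential supremum of `-Y`. It turns the almost sure solvency constraint
into a bound on the capital. -/
theorem exists_ae_nonneg_add_iff {Ω : Type*} [MeasurableSpace Ω] {P : Measure Ω} [NeZero P]
    (Y : Lp ℝ ∞ P) : ∃ l : ℝ, ∀ m, (∀ᵐ ω ∂P, 0 ≤ Y ω + m) ↔ l ≤ m := by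
  have hbd : ∀ᵐ ω ∂P, ‖Y ω‖ ≤ (eLpNormEssSup Y P).toReal := by
    have hfin : eLpNormEssSup Y P ≠ ⊤ := by
      rw [← eLpNorm_exponent_top]
      exact (Lp.memLp Y).eLpNorm_ne_top
    filter_upwards [ae_le_eLpNormEssSup (f := Y) (μ := P)] with ω hω
    have := ENNReal.toReal_mono hfin hω
    simpa using this
  set C := (eLpNormEssSup Y P).toReal
  have hup : IsBoundedUnder (· ≤ ·) (ae P) fun ω => -Y ω :=
    ⟨C, by
      rw [eventually_map]
      filter_upwards [hbd] with ω hω using (neg_le_abs _).trans hω⟩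
  have hlow : IsCoboundedUnder (· ≤ ·) (ae P) fun ω => -Y ω := by
    refine IsBoundedUnder.isCoboundedUnder_le ⟨-C, ?_⟩
    rw [eventually_map]
    filter_upwards [hbd] with ω hω
    have := (le_abs_self _).trans hω
    simpa using this
  refine ⟨essSup (fun ω => -Y ω) P, fun m => ⟨fun h => ?_, fun h => ?_⟩⟩
  · refine essSup_le_of_ae_le m ?_ hlow
    filter_upwards [h] with ω hω
    change -Y ω ≤ m
    linarith
  · filter_upwards [ae_le_essSup hup] with ω hω
    linarith

/-! ### Best replies as a contraction. -/

namespace FinancialNetwork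

variable {N : ℕ} (net : FinancialNetwork N)

theorem exists_sum_rel_le_of_lt_relSociety
    (h : ∀ i, ((N : ℝ) - 2) / ((N : ℝ) - 1) < net.relSociety i) (hN : 1 ≤ N) :
    ∃ K : ℝ, 0 ≤ K ∧ K < 1 ∧ (∀ i, ∑ j, net.rel i j ≤ K) ∧ ((N : ℝ) - 1) * K < 1 := by
  have : Nonempty (Fin N) := ⟨⟨0, hN⟩⟩
  obtain ⟨i, hi⟩ := Finite.exists_max fun i => ∑ j, net.rel i j
  refine ⟨_, Finset.sum_nonneg fun j _ => net.rel_nonneg i j, net.sum_rel_lt_one i, hi, ?_⟩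
  -- For one bank the factor `N - 1` is zero; there `h` reads `0 < relSociety i` by the convention
  -- for division by zero. Otherwise `K = 1 - relSociety i < 1 / (N - 1)`.
  rcases hN.eq_or_lt with h1 | h1
  · simp [← h1]
  · have h2 : (0 : ℝ) < (N : ℝ) - 1 := by
      have : (1 : ℝ) < N := by exact_mod_cast h1
      linarith
    have h3 := h i
    rw [div_lt_iff₀ h2] at h3
    have h4 := net.relSociety_add_sum_rel i
    have h5 : ∑ j, net.rel i j = 1 - net.relSociety i := by linarith
    rw [h5]
    linarith

theorem le_of_isAcceptable_update {Ω : Type*} [MeasurableSpace Ω] {P : Measure Ω} {γ : ℝ}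
    {X : Fin N → Lp ℝ ∞ P} {l : Fin N → ℝ} {A : Set (Lp ℝ ∞ P)}
    (hl : ∀ j m, (∀ᵐ ω ∂P, 0 ≤ X j ω + m) ↔ l j ≤ m) {w : Fin N → ℝ} {i : Fin N} {m : ℝ}
    (h : IsAcceptable A (net.aggregation γ i) X (Function.update w i m)) : l i ≤ m := by
  have := net.nonneg_of_isAcceptable h i
  rwa [hl, Function.update_self] at this

section NashAllocationRule

variable {Ω : Type*} [MeasurableSpace Ω] {P : Measure Ω} [IsProbabilityMeasure P]
  {ρ : Lp ℝ ∞ P → ℝ} {γ : ℝ} {X : Fin N → Lp ℝ ∞ P} {l : Fin N → ℝ}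

/-- Sufficient capital makes the position of bank `i` acceptable. -/
theorem exists_isAcceptable_update (hρ : IsCoherentRiskMeasure ρ) (hγ : γ ≤ 1)
    (hl : ∀ j m, (∀ᵐ ω ∂P, 0 ≤ X j ω + m) ↔ l j ≤ m) {w : Fin N → ℝ} (hw : l ≤ w) (i : Fin N) :
    ∃ m, IsAcceptable (acceptanceSet ρ) (net.aggregation γ i) X (Function.update w i m) := by
  set u := Function.update w i (l i + net.total i) with hu
  have hu0 : ∀ j, ∀ᵐ ω ∂P, 0 ≤ X j ω + u j := by
    intro j
    rw [hl]
    rcases eq_or_ne j i with rfl | hj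
    · simp [hu, (net.total_pos j).le]
    · simpa [hu, hj] using hw j
  obtain ⟨Z, hZ⟩ := net.exists_Lp_aggregation γ i hu0
  refine ⟨_, Z, ?_, hZ⟩
  have h0 : ρ Z ≤ ρ 0 := by
    refine hρ.monotone Z 0 ?_
    rw [← Lp.coeFn_nonneg]
    filter_upwards [hZ, (hl i (l i)).2 le_rfl, ae_all_iff.2 hu0] with ω h1 h2 h3
    have h4 : net.clearingVector ((fun j => X j ω) + u) i = net.total i := by
      refine net.clearingVector_eq_total h3 ?_
      simp only [hu, Function.update_self]
      linarith
    rw [← (net.aggregation_eq_coe_iff.1 h1).2, h4, relSociety_mul_total]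
    have := net.society_pos i
    change 0 ≤ _
    nlinarith
  rwa [hρ.normalized] at h0

/-- This is the Lipschitz estimate for best replies: each of the `N - 1` other banks withdraws at
most `d`, and bank `i` need only replace the share `K` of it. -/
theorem isAcceptable_update_add (hρ : IsCoherentRiskMeasure ρ)
    (hl : ∀ j m, (∀ᵐ ω ∂P, 0 ≤ X j ω + m) ↔ l j ≤ m) {K : ℝ} (hK0 : 0 ≤ K) (hK1 : K < 1)
    (hK : ∀ i, ∑ j, net.rel i j ≤ K) {v w : Fin N → ℝ} (hw : l ≤ w) {d : ℝ} (hd0 : 0 ≤ d)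
    (hd : ∀ j, v j - d ≤ w j) {i : Fin N} {m : ℝ}
    (h : IsAcceptable (acceptanceSet ρ) (net.aggregation γ i) X (Function.update v i m)) :
    IsAcceptable (acceptanceSet ρ) (net.aggregation γ i) X
      (Function.update w i (m + ((N : ℝ) - 1) * K * d)) := by
  have hN : 1 ≤ N := i.pos
  have hN' : (1 : ℝ) ≤ N := by exact_mod_cast hN
  have hinc : 0 ≤ ((N : ℝ) - 1) * K * d := mul_nonneg (mul_nonneg (by linarith) hK0) hd0
  refine net.isAcceptable_mono hρ h (fun j => ?_) (Eventually.of_forall fun ω => ?_)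
  · rw [hl]
    rcases eq_or_ne j i with rfl | hj
    · have := net.le_of_isAcceptable_update hl h
      rw [Function.update_self]
      linarith
    · rw [Function.update_of_ne hj]
      exact hw j
  · refine net.clearingVector_le_of_compensated hK1 hK (d := fun _ => d) (fun _ => hd0) ?_ ?_
    · simp only [Pi.add_apply, Function.update_self, Finset.sum_const, nsmul_eq_mul,
        Finset.card_erase_of_mem (Finset.mem_univ i), Finset.card_univ, Fintype.card_fin]
      rw [Nat.cast_sub hN, Nat.cast_one]
      linarith
    · intro k hk
      simp only [Pi.add_apply, Function.update_of_ne hk]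
      linarith [hd k]

theorem existsUnique_isNashAllocationAt (hρ : IsCoherentRiskMeasure ρ) (hγ : γ ≤ 1) (hN : 1 ≤ N)
    (h : ∀ i, ((N : ℝ) - 2) / ((N : ℝ) - 1) < net.relSociety i) (X : Fin N → Lp ℝ ∞ P) :
    ∃! v, IsNashAllocationAt (acceptanceSet ρ) (net.aggregation γ) X v := by
  obtain ⟨K, hK0, hK1, hK, hKN⟩ := net.exists_sum_rel_le_of_lt_relSociety h hN
  choose l hl using fun j => exists_ae_nonneg_add_iff (X j)
  let S : (Fin N → ℝ) → Fin N → Set ℝ := fun v i =>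
    {m | IsAcceptable (acceptanceSet ρ) (net.aggregation γ i) X (Function.update v i m)}
  -- Without the truncation at `l` the sets could be empty. It is harmless, since values of `T` and
  -- Nash allocations both dominate `l`, and it does not increase distances.
  let T : (Fin N → ℝ) → Fin N → ℝ := fun v i => sInf (S (v ⊔ l) i)
  have hbdd : ∀ v i, BddBelow (S v i) := fun v i =>
    ⟨l i, fun m hm => net.le_of_isAcceptable_update hl hm⟩
  have hne : ∀ v i, (S (v ⊔ l) i).Nonempty := fun v i =>
    net.exists_isAcceptable_update hρ hγ hl le_sup_right i
  have hlT : ∀ v, l ≤ T v := fun v i =>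
    le_csInf (hne v i) fun m hm => net.le_of_isAcceptable_update hl hm
  have hN' : (1 : ℝ) ≤ N := by exact_mod_cast hN
  have hL0 : 0 ≤ ((N : ℝ) - 1) * K := mul_nonneg (by linarith) hK0
  have hTle : ∀ v w i, T w i ≤ T v i + ((N : ℝ) - 1) * K * dist v w := by
    intro v w i
    rw [← sub_le_iff_le_add]
    refine le_csInf (hne v i) fun m hm => ?_
    rw [sub_le_iff_le_add]
    refine csInf_le (hbdd _ _) (net.isAcceptable_update_add hρ hl hK0 hK1 hK le_sup_right
      dist_nonneg (fun j => ?_) hm)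
    have h1 := (abs_le.1 ((Real.dist_eq _ _).symm.trans_le (dist_le_pi_dist v w j))).2
    have h2 : (v ⊔ l) j ≤ (w ⊔ l) j + dist v w := by
      simp only [Pi.sup_apply]
      refine sup_le ?_ ?_
      · linarith [le_sup_left (a := w j) (b := l j)]
      · linarith [le_sup_right (a := w j) (b := l j), dist_nonneg (x := v) (y := w)]
    linarith
  obtain ⟨L, hL⟩ : ∃ L : NNReal, (L : ℝ) = ((N : ℝ) - 1) * K := ⟨⟨_, hL0⟩, rfl⟩
  have hT : ContractingWith L T := by
    rw [← hL] at hKN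
    refine ⟨by exact_mod_cast hKN, LipschitzWith.of_dist_le_mul fun v w => ?_⟩
    rw [dist_pi_le_iff (by positivity)]
    intro i
    rw [Real.dist_eq, abs_sub_le_iff, hL]
    have h1 := hTle v w i
    have h2 := hTle w v i
    rw [dist_comm w v] at h2
    exact ⟨by linarith, by linarith⟩
  refine ⟨hT.fixedPoint T, ?_, fun v hv => ?_⟩
  · have hfix : T (hT.fixedPoint T) = hT.fixedPoint T := hT.fixedPoint_isFixedPt
    have hsup : hT.fixedPoint T ⊔ l = hT.fixedPoint T := by
      rw [sup_eq_left, ← hfix]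
      exact hlT _
    intro i
    have h1 := isGLB_csInf (hne (hT.fixedPoint T) i) (hbdd _ i)
    change IsGLB _ (T (hT.fixedPoint T) i) at h1
    rwa [hfix, hsup] at h1
  · have hlv : l ≤ v := fun i => (hv i).2 fun m hm => net.le_of_isAcceptable_update hl hm
    have hsup : v ⊔ l = v := sup_eq_left.2 hlv
    refine hT.fixedPoint_unique (funext fun i => ?_)
    have h1 := hne v i
    change sInf (S (v ⊔ l) i) = v i
    rw [hsup] at h1 ⊢
    exact (hv i).csInf_eq h1

theorem existsUnique_isNashAllocationRule (hρ : IsCoherentRiskMeasure ρ) (hγ : γ ≤ 1) (hN : 1 ≤ N)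
    (h : ∀ i, ((N : ℝ) - 2) / ((N : ℝ) - 1) < net.relSociety i) :
    ∃! r : (Fin N → Lp ℝ ∞ P) → Fin N → ℝ,
      IsNashAllocationRule (acceptanceSet ρ) (net.aggregation γ) r := by
  choose r hr hr' using net.existsUnique_isNashAllocationAt hρ hγ hN h
  exact ⟨r, hr, fun r' h' => funext fun X => hr' X _ (h' X)⟩

end NashAllocationRule

end FinancialNetwork

/-! ### Payments of topped-up banks. -/

namespace FinancialNetwork

variable {N : ℕ} (net : FinancialNetwork N) {γ : ℝ}

/-- The payments when every bank is topped up to the fraction `γ` of its obligations. -/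
def IsToppedUpPayment (γ : ℝ) (p : Fin N → ℝ) : Prop :=
  ∀ i, p i = max (γ * net.total i) (min (net.total i) (∑ j, net.rel j i * p j))

/-- The allocation which tops the banks up to the fraction `γ`, given the payments `p`. -/
def topUpAllocation (γ : ℝ) (x p : Fin N → ℝ) (i : Fin N) : ℝ :=
  -x i + max 0 (γ * net.total i - ∑ j, net.rel j i * p j)

theorem gamma_mul_total_lt (hγ : γ < 1) (i : Fin N) : γ * net.total i < net.total i :=
  mul_lt_of_lt_one_left (net.total_pos i) hγ

variable {net}

theorem IsToppedUpPayment.le_of_subsolution {p q : Fin N → ℝ} (hq : net.IsToppedUpPayment γ q)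
    (hp : ∀ i, p i ≤ max (γ * net.total i) (min (net.total i) (∑ j, net.rel j i * p j))) :
    p ≤ q := by
  refine net.le_of_forall_le_or_sub_le fun i => ?_
  by_cases h : p i ≤ q i
  · exact Or.inl h
  · right
    have h1 := net.sum_rel_mul_sub_le p q i
    have h2 := hq i
    have h3 := hp i
    push Not at h
    rcases le_max_iff.1 h3 with h4 | h4
    -- Where `p i` exceeds `q i` it exceeds the floor, so it is bounded by the inflow, while `q i`
    -- is below `total i` and hence at least its own inflow.
    · exact absurd (h4.trans (le_max_left _ _)) (by rw [← h2]; exact h.not_ge)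
    · rw [le_min_iff] at h4
      have h5 : min (net.total i) (∑ j, net.rel j i * q j) ≤ q i := h2 ▸ le_max_right _ _
      rcases min_le_iff.1 h5 with h6 | h6 <;> linarith

theorem IsToppedUpPayment.unique {p q : Fin N → ℝ} (hp : net.IsToppedUpPayment γ p)
    (hq : net.IsToppedUpPayment γ q) : p = q :=
  le_antisymm (hq.le_of_subsolution fun i => (hp i).le) (hp.le_of_subsolution fun i => (hq i).le)

theorem IsToppedUpPayment.gamma_mul_total_le {p : Fin N → ℝ} (hp : net.IsToppedUpPayment γ p)
    (i : Fin N) : γ * net.total i ≤ p i :=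
  (le_max_left _ _).trans (hp i).ge

theorem IsToppedUpPayment.isClearingVector {p : Fin N → ℝ} (hp : net.IsToppedUpPayment γ p)
    (hγ : γ < 1) (x : Fin N → ℝ) :
    net.IsClearingVector (x + net.topUpAllocation γ x p) p := by
  intro i
  have h := hp i
  have hlt := net.gamma_mul_total_lt hγ i
  simp only [Pi.add_apply, topUpAllocation, add_neg_cancel_left]
  rcases le_total (γ * net.total i) (∑ j, net.rel j i * p j) with h1 | h1
  · rw [max_eq_right (le_min hlt.le h1)] at h
    rwa [max_eq_left (sub_nonpos.2 h1), zero_add]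
  · rw [max_eq_left ((min_le_right _ _).trans h1)] at h
    rw [max_eq_right (sub_nonneg.2 h1), sub_add_cancel, min_eq_right hlt.le]
    exact h

variable (net)

/-! ### Nash allocations at a deterministic shock. -/

section DeterministicShock

variable {Ω : Type*} [MeasurableSpace Ω] {P : Measure Ω} [IsProbabilityMeasure P]
  {ρ : Lp ℝ ∞ P → ℝ}

theorem isAcceptable_constShock_iff (hρ : IsCoherentRiskMeasure ρ) (x m : Fin N → ℝ) (i : Fin N) :
    IsAcceptable (acceptanceSet ρ) (net.aggregation γ i) (constShock P x) m ↔
      (∀ j, 0 ≤ x j + m j) ∧ γ * net.total i ≤ net.clearingVector (x + m) i := by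
  have hx : ∀ᵐ ω ∂P, (fun j => constShock P x j ω) = x := by
    have h : ∀ j, ∀ᵐ ω ∂P, constShock P x j ω = x j := fun j => Lp.coeFn_const ..
    filter_upwards [ae_all_iff.2 h] with ω hω using funext hω
  set c := net.relSociety i * net.clearingVector (x + m) i - γ * net.society i with hc
  have hc0 : 0 ≤ c ↔ γ * net.total i ≤ net.clearingVector (x + m) i := by
    rw [hc, ← net.relSociety_mul_total, mul_left_comm, ← mul_sub,
      mul_nonneg_iff_of_pos_left (net.relSociety_pos i), sub_nonneg]
  rw [← hc0]
  constructor
  · rintro ⟨Y, hYA, hY⟩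
    have h1 : ∀ᵐ ω ∂P, (∀ j, 0 ≤ x j + m j) ∧ c = Y ω := by
      filter_upwards [hx, hY] with ω h1 h2
      rw [h1] at h2
      exact net.aggregation_eq_coe_iff.1 h2
    refine ⟨h1.exists.choose_spec.1, ?_⟩
    have h2 : Y = Lp.const ∞ P c := by
      refine Lp.ext ?_
      filter_upwards [h1, Lp.coeFn_const (p := ∞) (μ := P) (c := c)] with ω h3 h4
      rw [h4, ← h3.2]
      rfl
    have h3 : ρ Y ≤ 0 := hYA
    rw [h2, hρ.apply_const] at h3
    linarith
  · rintro ⟨h1, h2⟩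
    refine ⟨Lp.const ∞ P c, ?_, ?_⟩
    · change ρ _ ≤ 0
      rw [hρ.apply_const]
      linarith
    · filter_upwards [hx, Lp.coeFn_const (p := ∞) (μ := P) (c := c)] with ω h3 h4
      rw [h3, h4, net.aggregation_eq_coe h1]
      rfl

theorem isNashAllocationAt_topUpAllocation (hρ : IsCoherentRiskMeasure ρ) (hγ : γ < 1)
    (x : Fin N → ℝ) {p : Fin N → ℝ} (hp : net.IsToppedUpPayment γ p) :
    IsNashAllocationAt (acceptanceSet ρ) (net.aggregation γ) (constShock P x)
      (net.topUpAllocation γ x p) := by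
  intro i
  set v := net.topUpAllocation γ x p with hv
  have hpv := (hp.isClearingVector hγ x).eq_clearingVector
  rw [← hv] at hpv
  have hpos : ∀ j, 0 ≤ x j + v j := fun j => by simp [hv, topUpAllocation]
  refine IsLeast.isGLB ⟨?_, fun m hm => ?_⟩
  · rw [Set.mem_ofPred_eq, Function.update_eq_self, net.isAcceptable_constShock_iff hρ]
    exact ⟨hpos, hpv ▸ hp.gamma_mul_total_le i⟩
  · rw [Set.mem_ofPred_eq, net.isAcceptable_constShock_iff hρ] at hm
    obtain ⟨hm0, hm1⟩ := hm
    have hmi := hm0 i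
    rw [Function.update_self] at hmi
    by_contra! hlt
    -- Solvency at `m < v i` means that `v i` fills a positive shortfall. Less capital lowers all
    -- payments, so the inflow of bank `i` cannot make up for it.
    have hb : 0 < γ * net.total i - ∑ j, net.rel j i * p j := by
      by_contra! hb
      have : v i = -x i + 0 := by rw [hv, topUpAllocation, max_eq_left hb]
      linarith
    have hvi : v i = -x i + (γ * net.total i - ∑ j, net.rel j i * p j) := by
      rw [hv, topUpAllocation, max_eq_right hb.le]
    have hle : x + Function.update v i m ≤ x + v :=
      add_le_add_right (update_le_self_iff.2 hlt.le) x
    have h1 := net.sum_rel_mul_mono (net.clearingVector_mono hle) i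
    have h2 := net.clearingVector_le (x + Function.update v i m) i
    rw [← hpv] at h1
    rw [Pi.add_apply, Function.update_self] at h2
    linarith

theorem exists_isToppedUpPayment_of_isNashAllocationAt (hρ : IsCoherentRiskMeasure ρ) (hγ : γ < 1)
    {x v : Fin N → ℝ}
    (hv : IsNashAllocationAt (acceptanceSet ρ) (net.aggregation γ) (constShock P x) v) :
    ∃ p, net.IsToppedUpPayment γ p ∧ v = net.topUpAllocation γ x p := by
  have hset : ∀ i, {m | IsAcceptable (acceptanceSet ρ) (net.aggregation γ i) (constShock P x)
      (Function.update v i m)} = {m | (∀ j, 0 ≤ x j + Function.update v i m j) ∧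
        γ * net.total i ≤ net.clearingVector (x + Function.update v i m) i} := fun i =>
    Set.ext fun m => net.isAcceptable_constShock_iff hρ _ _ _
  have hcont : ∀ i, Continuous fun m => net.clearingVector (x + Function.update v i m) i :=
    fun i => (continuous_apply i).comp (net.continuous_clearingVector.comp
      (continuous_const.add (continuous_const.update i continuous_id)))
  have hmem : ∀ i, (∀ j, 0 ≤ x j + v j) ∧ γ * net.total i ≤ net.clearingVector (x + v) i := by
    intro i
    have h := hv i
    rw [hset] at h
    have hclosed : IsClosed {m | (∀ j, 0 ≤ x j + Function.update v i m j) ∧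
        γ * net.total i ≤ net.clearingVector (x + Function.update v i m) i} := by
      refine IsClosed.inter (s₁ := {m | ∀ j, 0 ≤ x j + Function.update v i m j}) ?_
        (isClosed_le continuous_const (hcont i))
      rw [Set.ofPred_forall]
      have hupd : Continuous fun m => Function.update v i m :=
        continuous_const.update i continuous_id
      exact isClosed_iInter fun j => isClosed_le continuous_const
        (continuous_const.add ((continuous_apply j).comp hupd))
    -- The infimum is attained because the set is closed. It is nonempty because a greatest lower
    -- bound of `∅` would be a top element of `ℝ`.
    have h1 := hclosed.closure_eq ▸ h.mem_closure (by
      by_contra hne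
      rw [Set.not_nonempty_iff_eq_empty] at hne
      rw [hne, isGLB_empty_iff] at h
      exact not_isTop _ h)
    simpa using h1
  set p := net.clearingVector (x + v) with hp
  -- Complementary slackness: by continuity, a bank with positive assets paying more than required
  -- could give up a little capital.
  have hslack : ∀ i, 0 < x i + v i → p i ≤ γ * net.total i := by
    intro i hi
    by_contra! hlt
    have hopen : IsOpen {m | 0 < x i + m ∧
        γ * net.total i < net.clearingVector (x + Function.update v i m) i} :=
      IsOpen.inter (isOpen_lt continuous_const (continuous_const.add continuous_id))
        (isOpen_lt continuous_const (hcont i))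
    have hnhds := hopen.mem_nhds (x := v i) (by simpa [← hp] using ⟨hi, hlt⟩)
    obtain ⟨m, ⟨hm1, hm2⟩, hm3⟩ : ∃ m, (0 < x i + m ∧
        γ * net.total i < net.clearingVector (x + Function.update v i m) i) ∧ m < v i :=
      (Filter.nonempty_of_mem (inter_mem (mem_nhdsWithin_of_mem_nhds hnhds)
        (self_mem_nhdsWithin (s := Set.Iio (v i)))))
    have h := hv i
    rw [hset] at h
    refine hm3.not_ge (h.1 ⟨fun j => ?_, hm2.le⟩)
    rcases eq_or_ne j i with rfl | hj
    · simpa using hm1.le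
    · simpa [hj] using (hmem i).1 j
  have hclear := net.clearingVector_spec (x + v)
  rw [← hp] at hclear
  have key : ∀ i, p i = max (γ * net.total i) (min (net.total i) (∑ j, net.rel j i * p j)) ∧
      v i = net.topUpAllocation γ x p i := by
    intro i
    have hγi := net.gamma_mul_total_lt hγ i
    have hge := (hmem i).2
    have hci := hclear i
    rw [Pi.add_apply] at hci
    unfold topUpAllocation
    rcases ((hmem i).1 i).eq_or_lt with h0 | h0
    · rw [← h0, zero_add] at hci
      have h1 : γ * net.total i ≤ ∑ j, net.rel j i * p j := hge.trans (hci.trans_le (min_le_right _ _))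
      rw [← hci, max_eq_right hge, max_eq_left (sub_nonpos.2 h1)]
      exact ⟨rfl, by linarith⟩
    · have h1 : p i = γ * net.total i := le_antisymm (hslack i h0) hge
      have h2 : p i = x i + v i + ∑ j, net.rel j i * p j :=
        net.clearingVector_eq_of_lt (x := x + v) (h1.trans_lt hγi)
      have h3 : ∑ j, net.rel j i * p j ≤ γ * net.total i := by linarith
      rw [max_eq_left ((min_le_right _ _).trans h3), max_eq_right (sub_nonneg.2 h3)]
      exact ⟨h1, by linarith⟩
  exact ⟨p, fun i => (key i).1, funext fun i => (key i).2⟩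

theorem isNashAllocationAt_constShock_iff (hρ : IsCoherentRiskMeasure ρ) (hγ : γ < 1)
    (x v : Fin N → ℝ) {p : Fin N → ℝ} (hp : net.IsToppedUpPayment γ p) :
    IsNashAllocationAt (acceptanceSet ρ) (net.aggregation γ) (constShock P x) v ↔
      v = net.topUpAllocation γ x p := by
  constructor
  · intro hv
    obtain ⟨q, hq, rfl⟩ := net.exists_isToppedUpPayment_of_isNashAllocationAt hρ hγ hv
    rw [hp.unique hq]
  · rintro rfl
    exact net.isNashAllocationAt_topUpAllocation hρ hγ x hp

end DeterministicShock

/-! ### The iteration and its termination. -/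

section Stages

theorem stagePayment_of_notMem {I : Finset (Fin N)} {i : Fin N} (hi : i ∉ I) :
    net.stagePayment γ I i = γ * net.total i :=
  (Classical.choose_spec (net.existsUnique_isStagePayment γ I).exists).1 i hi

/-- Since `γ * owed j i = rel j i * (γ * total j)`, the two sums of the stage merge into the total
inflow. -/
theorem stagePayment_of_mem {I : Finset (Fin N)} {i : Fin N} (hi : i ∈ I) :
    net.stagePayment γ I i =
      min (net.total i) (∑ j, net.rel j i * net.stagePayment γ I j) := by
  have h : net.stagePayment γ I i = min (net.total i) (γ * ∑ j ∈ Iᶜ, net.owed j i +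
      ∑ j ∈ I, net.rel j i * net.stagePayment γ I j) :=
    (Classical.choose_spec (net.existsUnique_isStagePayment γ I).exists).2 i hi
  rw [h, ← Finset.sum_compl_add_sum I, Finset.mul_sum]
  congr 2
  refine Finset.sum_congr rfl fun j hj => ?_
  rw [net.stagePayment_of_notMem (Finset.mem_compl.1 hj), rel, mul_left_comm,
    div_mul_cancel₀ _ (net.total_pos j).ne']

theorem le_stagePayment_of_subsolution {I : Finset (Fin N)} {p : Fin N → ℝ}
    (h1 : ∀ i, i ∉ I → p i ≤ γ * net.total i)
    (h2 : ∀ i, i ∈ I → p i ≤ min (net.total i) (∑ j, net.rel j i * p j)) :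
    p ≤ net.stagePayment γ I := by
  refine net.le_of_forall_le_or_sub_le fun i => ?_
  by_cases hi : i ∈ I
  · rcases min_choice (net.total i) (∑ j, net.rel j i * net.stagePayment γ I j) with h | h
    · left
      rw [net.stagePayment_of_mem hi, h]
      exact (h2 i hi).trans (min_le_left _ _)
    · right
      rw [net.stagePayment_of_mem hi, h]
      have h3 := net.sum_rel_mul_sub_le p (net.stagePayment γ I) i
      linarith [(h2 i hi).trans (min_le_right _ _)]
  · left
    rw [net.stagePayment_of_notMem hi]
    exact h1 i hi

variable (x : Fin N → ℝ)

theorem mem_stageSet_succ {k : ℕ} {i : Fin N} :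
    i ∈ net.stageSet γ x (k + 1) ↔ i ∈ net.stageSet γ x k ∨ γ * net.total i ≤
      ∑ j, net.rel j i * net.stagePayment γ (net.stageSet γ x k) j := by
  rw [stageSet, Finset.mem_filter_univ, stageAllocation]
  split_ifs with h
  · simp [h]
  · simp only [h, false_or]
    constructor <;> intro h' <;> linarith

theorem stageSet_subset_succ (k : ℕ) : net.stageSet γ x k ⊆ net.stageSet γ x (k + 1) :=
  fun _ hi => (net.mem_stageSet_succ x).2 (Or.inl hi)

/-- A bank joins the set only when its inflow covers `γ * total i`, so the old payments form a
subsolution of the new stage and payments can only rise. -/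
theorem gamma_mul_total_le_stagePayment (hγ : γ < 1) (k : ℕ) (i : Fin N) :
    γ * net.total i ≤ net.stagePayment γ (net.stageSet γ x k) i := by
  induction k generalizing i with
  | zero => exact (net.stagePayment_of_notMem (Finset.notMem_empty i)).ge
  | succ k ih =>
    refine (ih i).trans (net.le_stagePayment_of_subsolution (fun i hi => ?_) (fun i hi => ?_) i)
    · exact (net.stagePayment_of_notMem fun h => hi (net.stageSet_subset_succ x k h)).le
    · by_cases hk : i ∈ net.stageSet γ x k
      · exact (net.stagePayment_of_mem hk).le
      · rw [net.stagePayment_of_notMem hk]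
        exact le_min (net.gamma_mul_total_lt hγ i).le
          (((net.mem_stageSet_succ x).1 hi).resolve_left hk)

theorem gamma_mul_total_le_sum_of_mem (hγ : γ < 1) {k : ℕ} {i : Fin N}
    (hi : i ∈ net.stageSet γ x k) :
    γ * net.total i ≤ ∑ j, net.rel j i * net.stagePayment γ (net.stageSet γ x k) j :=
  (net.gamma_mul_total_le_stagePayment x hγ k i).trans
    ((net.stagePayment_of_mem hi).trans_le (min_le_right _ _))

/-- Not all banks can default without capital: society would be paid out of nothing. -/
theorem stageSet_ne_univ (hN : 1 ≤ N) (hγ₀ : 0 < γ) (hγ₁ : γ < 1) (k : ℕ) :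
    net.stageSet γ x k ≠ Finset.univ := by
  intro h
  -- With every bank in the set there are no external assets, and comparison with `0` contradicts
  -- the positive floor `γ * total`.
  have h0 : net.stagePayment γ (net.stageSet γ x k) ≤ 0 := by
    refine net.le_of_forall_le_or_sub_le fun i => Or.inr ?_
    have h1 := net.sum_rel_mul_sub_le (net.stagePayment γ (net.stageSet γ x k)) 0 i
    have h2 := (net.stagePayment_of_mem (γ := γ) (h ▸ Finset.mem_univ i)).trans_le
      (min_le_right _ _)
    simp only [Pi.zero_apply, mul_zero, Finset.sum_const_zero, sub_zero] at h1 ⊢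
    exact h2.trans h1
  have h1 := net.gamma_mul_total_le_stagePayment x hγ₁ k ⟨0, hN⟩
  have h2 := mul_pos hγ₀ (net.total_pos ⟨0, hN⟩)
  have h3 := h0 ⟨0, hN⟩
  simp only [Pi.zero_apply] at h3
  linarith

theorem exists_stageSet_succ_eq (hN : 1 ≤ N) (hγ₀ : 0 < γ) (hγ₁ : γ < 1) :
    ∃ k < N, net.stageSet γ x (k + 1) = net.stageSet γ x k := by
  by_contra! h
  -- Strict growth in each of the steps `0, …, N - 1` would make the set at stage `N` full.
  have hcard : ∀ k ≤ N, k ≤ (net.stageSet γ x k).card := by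
    intro k
    induction k with
    | zero => simp
    | succ k ih =>
      intro hk
      have := Finset.card_lt_card
        ((net.stageSet_subset_succ x k).ssubset_of_ne (h k hk).symm)
      have := ih (by omega)
      omega
  refine net.stageSet_ne_univ x hN hγ₀ hγ₁ N ((Finset.card_eq_iff_eq_univ _).1 ?_)
  exact le_antisymm (Finset.card_le_univ _) (by simpa using hcard N le_rfl)

/-- Stationarity means that banks outside the set receive less than `γ * total i`, so the floor
attains the maximum there; inside, payments are already above the floor. -/
theorem isToppedUpPayment_stagePayment (hγ : γ < 1) {k : ℕ}
    (hk : net.stageSet γ x (k + 1) = net.stageSet γ x k) :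
    net.IsToppedUpPayment γ (net.stagePayment γ (net.stageSet γ x k)) := by
  intro i
  by_cases hi : i ∈ net.stageSet γ x k
  · rw [← net.stagePayment_of_mem hi,
      max_eq_right (net.gamma_mul_total_le_stagePayment x hγ k i)]
  · have h1 : i ∉ net.stageSet γ x (k + 1) := hk ▸ hi
    rw [mem_stageSet_succ, not_or, not_le] at h1
    rw [max_eq_left ((min_le_right _ _).trans h1.2.le), net.stagePayment_of_notMem hi]

theorem stageAllocation_eq_topUpAllocation (hγ : γ < 1) {k : ℕ}
    (hk : net.stageSet γ x (k + 1) = net.stageSet γ x k) :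
    net.stageAllocation γ x (net.stageSet γ x k) =
      net.topUpAllocation γ x (net.stagePayment γ (net.stageSet γ x k)) := by
  funext i
  unfold stageAllocation topUpAllocation
  split_ifs with hi
  · rw [max_eq_left (sub_nonpos.2 (net.gamma_mul_total_le_sum_of_mem x hγ hi)), add_zero]
  · have h1 : i ∉ net.stageSet γ x (k + 1) := hk ▸ hi
    rw [mem_stageSet_succ, not_or, not_le] at h1
    rw [max_eq_right (sub_nonneg.2 h1.2.le)]
    ring

end Stages

end FinancialNetwork

end

/-- Continuity from above is not needed: the infimum defining a Nash allocation need not be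
attained in the contraction argument. -/
theorem mainTheorem9 {N : ℕ} (hN : 1 ≤ N) (net : FinancialNetwork N)
    {γ : ℝ} (hγ₀ : 0 < γ) (hγ₁ : γ < 1)
    {Ω : Type*} [MeasurableSpace Ω] (P : Measure Ω) [IsProbabilityMeasure P]
    (ρ : Lp ℝ ∞ P → ℝ) (hρ : IsCoherentRiskMeasure ρ) (hρc : IsContinuousFromAbove ρ) :
    ((∀ i, ((N : ℝ) - 2) / ((N : ℝ) - 1) < net.relSociety i) →
      ∃! r : (Fin N → Lp ℝ ∞ P) → Fin N → ℝ,
        IsNashAllocationRule (acceptanceSet ρ) (net.aggregation γ) r) ∧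
    ∀ x : Fin N → ℝ,
      (∀ k, net.stageSet γ x k ⊆ net.stageSet γ x (k + 1)) ∧
      ∃ k < N,
        net.stageSet γ x (k + 1) = net.stageSet γ x k ∧
        (∀ l < k, net.stageSet γ x (l + 1) ≠ net.stageSet γ x l) ∧
        (∀ v : Fin N → ℝ,
          IsNashAllocationAt (acceptanceSet ρ) (net.aggregation γ) (constShock P x) v ↔
            v = net.stageAllocation γ x (net.stageSet γ x k)) ∧
        ∀ r : (Fin N → Lp ℝ ∞ P) → Fin N → ℝ,
          IsNashAllocationRule (acceptanceSet ρ) (net.aggregation γ) r →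
            r (constShock P x) = net.stageAllocation γ x (net.stageSet γ x k) := by
  refine ⟨net.existsUnique_isNashAllocationRule hρ hγ₁.le hN, fun x =>
    ⟨net.stageSet_subset_succ x, ?_⟩⟩
  classical
  have hex := net.exists_stageSet_succ_eq x hN hγ₀ hγ₁
  have hex' : ∃ k, net.stageSet γ x (k + 1) = net.stageSet γ x k := hex.imp fun _ h => h.2
  obtain ⟨k, hk, hkN⟩ := hex
  have hfind := Nat.find_spec hex'
  have hiff : ∀ v : Fin N → ℝ,
      IsNashAllocationAt (acceptanceSet ρ) (net.aggregation γ) (constShock P x) v ↔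
        v = net.stageAllocation γ x (net.stageSet γ x (Nat.find hex')) := fun v => by
    rw [net.stageAllocation_eq_topUpAllocation x hγ₁ hfind]
    exact net.isNashAllocationAt_constShock_iff hρ hγ₁ x v
      (net.isToppedUpPayment_stagePayment x hγ₁ hfind)
  exact ⟨Nat.find hex', (Nat.find_min' hex' hkN).trans_lt hk, hfind,
    fun l hl => Nat.find_min hex' hl, hiff, fun r hr => (hiff _).1 (hr _)⟩
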